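/- Consider stochastic multi-objective bandits with two arms and $D$-dimensional rewards, where $D\ge 2$. An instance is a pair of probability laws $\nu^1,\nu^2$ on $\mathbb{R}^D$ with mean vectors $\mu^1,\mu^2\in[0,1]^D$. The reward vectors $r^{i,t}$ ($i=1,2$; $t=1,\dots,T$) are independent, with $r^{i,t}\sim\nu^i$. A randomized algorithm chooses the arm $a_t$ at random, with a distribution that depends (measurably) on the past pulls and on the observed rewards $r^{a_s,s}$, $s<t$, only. For $a,b\in\mathbb{R}^D$ write $a\,\|\,b$ if $a_d>b_d$ for some $d$ and $a_{d'}<b_{d'}$ for some $d'$. Let $O'$ be the set of those total reward vectors $\sum_{t=1}^T r^{i,t}$ that exceed the total reward vector of every other arm in at least one coordinate. The Pareto regret is $$R'_T=\inf\Big\{\epsilon\ge 0:\ \sum_{t=1}^T r^{a_t,t}+\epsilon\mathbf{1}\ \big\|\ \sigma\ \text{ for every }\sigma\in O'\Big\},\qquad \mathbf{1}=(1,\dots,1),$$ where $R'_T$ is taken to be $0$ when there is no such $\epsilon$. For small horizons there are instances on which the expected Pareto regret of every randomized algorithm is of order at least $\log T$. Precisely, for every $D\ge2$: (a) There is an instance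 with all rewards in $[0,1]^D$ and with $\mu^1=m_1\mathbf{1}$, $\mu^2=m_2\mathbf{1}$, $m_1<m_2$, such that for every integer $T$ with $11<T\le 1200$ and every randomized algorithm, $E[R'_T]>\tfrac14\log T$. (b) There is an instance with $|r^{i,t}_d-\mu^i_d|\le 2$ for all $i,t,d$ almost surely and with $\mu^1=m_1\mathbf{1}$, $\mu^2=m_2\mathbf{1}$, $m_1<m_2$, such that for every integer $T$ with $11<T\le 1200$ and every randomized algorithm, $E[R'_T]>\log T$. -/

import Mathlib

open MeasureTheory ProbabilityTheory
open scoped ENNReal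

namespace MOBandit

/-! Multi-objective bandits with `K` arms and `D`-dimensional reward vectors. -/

/-- `a` is incomparable with `b`: strictly larger in some coordinate and strictly smaller in
some other coordinate. -/
def Incomparable {D : ℕ} (a b : Fin D → ℝ) : Prop :=
  (∃ d, b d < a d) ∧ ∃ d, a d < b d

/-- `a` is non-dominated by `b`: some coordinate of `a` is strictly larger. -/
def NonDominatedBy {D : ℕ} (a b : Fin D → ℝ) : Prop :=
  ∃ d, b d < a d

/-- The distance from `a` to a set `O`: the least `ε ≥ 0` such that `a + ε 1` is incomparable with
every element of `O`. The infimum replaces the minimum, because the set of these `ε` need not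
contain its infimum. When there is no such `ε` (for instance if `a ∈ O`), the value is `0`, the
least that a distance can be, so that such `a` never contribute to a lower bound. -/
noncomputable def paretoDist {D : ℕ} (a : Fin D → ℝ) (O : Set (Fin D → ℝ)) : ℝ :=
  sInf {ε : ℝ | 0 ≤ ε ∧ ∀ σ ∈ O, Incomparable (fun d => a d + ε) σ}

/-- A table of reward vectors: `x t i d` is coordinate `d` of the reward vector of arm `i` at
time step `t`. -/
abbrev RewardTable (K D T : ℕ) : Type := Fin T → Fin K → Fin D → ℝ

/-- The cumulative reward vector of arm `i`. -/
def armTotal {K D T : ℕ} (x : RewardTable K D T) (i : Fin K) : Fin D → ℝ :=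
  fun d => ∑ t, x t i d

/-- The cumulative reward vector of a player who pulls arm `a t` at each time step `t`. -/
def playerTotal {K D T : ℕ} (x : RewardTable K D T) (a : Fin T → Fin K) : Fin D → ℝ :=
  fun d => ∑ t, x t (a t) d

/-- The Pareto optimal front of the realized cumulative reward vectors. -/
def paretoFront {K D T : ℕ} (x : RewardTable K D T) : Set (Fin D → ℝ) :=
  {σ | ∃ i, (∀ j, j ≠ i → NonDominatedBy (armTotal x i) (armTotal x j)) ∧ σ = armTotal x i}

/-- The (general) Pareto regret of the pulls `a` on the reward table `x`. -/
noncomputable def paretoRegret {K D T : ℕ} (x : RewardTable K D T) (a : Fin T → Fin K) : ℝ :=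
  paretoDist (playerTotal x a) (paretoFront x)

/-- A stochastic instance: each arm has a law of reward vectors, whose mean vector exists and lies
in the unit cube. -/
structure StochasticInstance (K D : ℕ) where
  law : Fin K → Measure (Fin D → ℝ)
  isProb : ∀ i, IsProbabilityMeasure (law i)
  integrable_coord : ∀ i d, Integrable (fun v : Fin D → ℝ => v d) (law i)
  mean_mem : ∀ i d, (∫ v, v d ∂(law i)) ∈ Set.Icc (0 : ℝ) 1

attribute [instance] StochasticInstance.isProb

namespace StochasticInstance

variable {K D : ℕ}

/-- The mean reward vector of arm `i`. -/
noncomputable def mean (ν : StochasticInstance K D) (i : Fin K) : Fin D → ℝ :=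
  fun d => ∫ v, v d ∂(ν.law i)

/-- The law of the reward table over `T` steps: reward vectors are independent over time steps and
arms, and those of arm `i` all have the law of arm `i`. -/
noncomputable def tableLaw (ν : StochasticInstance K D) (T : ℕ) : Measure (RewardTable K D T) :=
  Measure.pi fun _ => Measure.pi ν.law

end StochasticInstance

/-- What a player has seen before step `t`: the arms pulled so far and, for each of them, the
reward vector of the pulled arm only. -/
abbrev History (K D t : ℕ) : Type := Fin t → Fin K × (Fin D → ℝ)

/-- A randomized algorithm for horizon `T`: at each step, a probability distribution over the arms
that depends measurably on the history. -/
structure RandomizedAlgorithm (K D T : ℕ) where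
  policy : (t : Fin T) → Kernel (History K D t) (Fin K)
  isMarkov : ∀ t, IsMarkovKernel (policy t)

/-- The history before step `t` when the pulls are `a` on the reward table `x`. -/
def observed {K D T : ℕ} (x : RewardTable K D T) (a : Fin T → Fin K) (t : Fin T) :
    History K D t :=
  fun s => (a (s.castLE t.isLt.le), x (s.castLE t.isLt.le) (a (s.castLE t.isLt.le)))

/-- The conditional probability, given the reward table `x`, that the algorithm makes the
pulls `a`. -/
noncomputable def RandomizedAlgorithm.pullProb {K D T : ℕ} (π : RandomizedAlgorithm K D T)
    (x : RewardTable K D T) (a : Fin T → Fin K) : ℝ≥0∞ :=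
  ∏ t, π.policy t (observed x a t) {a t}

/-- The expected Pareto regret of an algorithm on a stochastic instance. The Pareto regret is
nonnegative, so the expectation is taken in `[0, ∞]`. -/
noncomputable def expectedParetoRegret {K D T : ℕ} (ν : StochasticInstance K D)
    (π : RandomizedAlgorithm K D T) : ℝ≥0∞ :=
  ∫⁻ x, ∑ a : Fin T → Fin K, π.pullProb x a * ENNReal.ofReal (paretoRegret x a) ∂(ν.tableLaw T)

end MOBandit

/-! The mechanism is selection in hindsight, not the difficulty of learning. Both arms flip
independent fair coins `± h` around means that differ only by a tiny `θ`. Whatever the algorithm,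
its expected total in one coordinate is at most `T * (1 / 2 + θ)` (`lintegral_collected_le`). The
larger of the two realized totals exceeds `T / 2` in expectation by about half the mean absolute
difference of the totals, hence by a multiple of `h * √T`. The resulting bound `h * √(T / 6) - 3 / 2
* (T * θ)` (`le_expectedParetoRegret`) beats the logarithm on the given range of horizons.

The coin is common to all coordinates, so the reward vectors are almost multiples of `1` and the
Pareto regret should be a scalar gap. Two degeneracies threaten this. If the arms tied, the front
would have two elements; the shift `θ` prevents it, as the difference of the totals lies in `2 * h *
ℤ - T * θ` with `T * θ < h`. If the vectors were exact multiples of `1`, no `ε` would give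
incomparability and the regret would be `0` by convention; a continuous perturbation of coordinate
`0` of arm `0` makes the coordinate gaps differ almost surely (`ae_perturbation_sum_ne_zero`). Then
`ae_le_paretoRegret` holds for all pull sequences at once.

The fluctuation is bounded below by a fourth moment argument (`sqrt_le_integral_abs_sum`). -/

namespace MOBandit

/-! ### Adaptive algorithms and their expected collected reward -/

variable {K D : ℕ}

attribute [instance] RandomizedAlgorithm.isMarkov

/-- The first `T` steps of an algorithm for horizon `T + 1`. -/
noncomputable def RandomizedAlgorithm.init {T : ℕ} (π : RandomizedAlgorithm K D (T + 1)) :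
    RandomizedAlgorithm K D T where
  policy t := π.policy t.castSucc
  isMarkov t := π.isMarkov t.castSucc

/-- The conditional probability of pulling arm `b` at the last step. -/
noncomputable def RandomizedAlgorithm.lastProb {T : ℕ} (π : RandomizedAlgorithm K D (T + 1))
    (x : RewardTable K D T) (a : Fin T → Fin K) (b : Fin K) : ℝ≥0∞ :=
  π.policy (Fin.last T) (fun s : Fin T => (a s, x s (a s))) {b}

theorem RandomizedAlgorithm.pullProb_succ {T : ℕ} (π : RandomizedAlgorithm K D (T + 1))
    (x : RewardTable K D (T + 1)) (a : Fin (T + 1) → Fin K) :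
    π.pullProb x a = π.init.pullProb (fun t => x t.castSucc) (fun t => a t.castSucc) *
      π.lastProb (fun t => x t.castSucc) (fun t => a t.castSucc) (a (Fin.last T)) := by
  unfold RandomizedAlgorithm.pullProb
  rw [Fin.prod_univ_castSucc]
  rfl

theorem RandomizedAlgorithm.sum_lastProb {T : ℕ} (π : RandomizedAlgorithm K D (T + 1))
    (x : RewardTable K D T) (a : Fin T → Fin K) : ∑ b, π.lastProb x a b = 1 := by
  unfold RandomizedAlgorithm.lastProb
  rw [sum_measure_singleton, Finset.coe_univ]
  exact ((π.isMarkov (Fin.last T)).isProbabilityMeasure _).measure_univ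

theorem sum_fun_fin_succ {M : Type*} [AddCommMonoid M] {T : ℕ} (F : (Fin (T + 1) → Fin K) → M) :
    ∑ a, F a = ∑ a' : Fin T → Fin K, ∑ b : Fin K, F (Fin.snoc a' b) := by
  rw [← (Fin.snocEquiv (fun _ : Fin (T + 1) => Fin K)).sum_comp, Fintype.sum_prod_type,
    Finset.sum_comm]
  rfl

theorem RandomizedAlgorithm.pullProb_snoc {T : ℕ} (π : RandomizedAlgorithm K D (T + 1))
    (x : RewardTable K D (T + 1)) (a : Fin T → Fin K) (b : Fin K) :
    π.pullProb x (Fin.snoc a b : Fin (T + 1) → Fin K) =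
      π.init.pullProb (fun t => x t.castSucc) a * π.lastProb (fun t => x t.castSucc) a b := by
  simp only [pullProb_succ, Fin.snoc_castSucc, Fin.snoc_last]

theorem RandomizedAlgorithm.sum_pullProb {T : ℕ} (π : RandomizedAlgorithm K D T)
    (x : RewardTable K D T) : ∑ a, π.pullProb x a = 1 := by
  induction T with
  | zero => simp [RandomizedAlgorithm.pullProb]
  | succ T ih =>
    rw [sum_fun_fin_succ]
    simp only [pullProb_snoc, ← Finset.mul_sum, sum_lastProb, mul_one, ih]

theorem measurable_observed {T : ℕ} (a : Fin T → Fin K) (t : Fin T) :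
    Measurable fun x : RewardTable K D T => observed x a t := by
  unfold observed
  fun_prop

theorem RandomizedAlgorithm.measurable_pullProb {T : ℕ} (π : RandomizedAlgorithm K D T)
    (a : Fin T → Fin K) : Measurable fun x => π.pullProb x a := by
  unfold RandomizedAlgorithm.pullProb
  refine Finset.measurable_prod _ fun t _ => ?_
  exact ((π.policy t).measurable_coe (measurableSet_singleton _)).comp (measurable_observed a t)

theorem RandomizedAlgorithm.measurable_lastProb {T : ℕ} (π : RandomizedAlgorithm K D (T + 1))
    (a : Fin T → Fin K) (b : Fin K) : Measurable fun x => π.lastProb x a b := by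
  unfold RandomizedAlgorithm.lastProb
  refine ((π.policy (Fin.last T)).measurable_coe (measurableSet_singleton _)).comp ?_
  change Measurable fun x : RewardTable K D T => fun s : Fin T => (a s, x s (a s))
  fun_prop

/-- An adaptive player cannot beat the best mean reward: if `f` has mean at most `m` under the law
of every arm, the expected total of `f` over the rewards collected is at most `T * m`. -/
theorem lintegral_collected_le (ν : StochasticInstance K D) {f : (Fin D → ℝ) → ℝ≥0∞}
    (hf : Measurable f) {m : ℝ≥0∞} (hm : ∀ i, ∫⁻ v, f v ∂(ν.law i) ≤ m) {T : ℕ}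
    (π : RandomizedAlgorithm K D T) :
    ∫⁻ x, ∑ a, π.pullProb x a * ∑ t, f (x t (a t)) ∂(ν.tableLaw T) ≤ T * m := by
  induction T with
  | zero => simp
  | succ T ih =>
    let g : RewardTable K D T → ℝ≥0∞ :=
      fun x => ∑ a, π.init.pullProb x a * ∑ t, f (x t (a t))
    let k : (Fin K → Fin D → ℝ) × RewardTable K D T → ℝ≥0∞ :=
      fun z => ∑ a : Fin T → Fin K, ∑ b, π.init.pullProb z.2 a * π.lastProb z.2 a b * f (z.1 b)
    have hstep : ∀ x : RewardTable K D (T + 1),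
        ∑ a, π.pullProb x a * ∑ t, f (x t (a t)) =
          g (fun t => x t.castSucc) + k (x (Fin.last T), fun t => x t.castSucc) := by
      intro x
      rw [sum_fun_fin_succ]
      simp only [RandomizedAlgorithm.pullProb_snoc, Fin.snoc_castSucc, Fin.snoc_last,
        Fin.sum_univ_castSucc, g, k,
        mul_add, Finset.sum_add_distrib]
      congr 1
      refine Finset.sum_congr rfl fun a _ => ?_
      rw [← Finset.sum_mul, ← Finset.mul_sum, π.sum_lastProb, mul_one]
    have hg : Measurable g := by
      refine Finset.measurable_sum _ fun a _ => (π.init.measurable_pullProb a).mul ?_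
      fun_prop
    have hk : Measurable k := by
      refine Finset.measurable_sum _ fun a _ => Finset.measurable_sum _ fun b _ => ?_
      refine (((π.init.measurable_pullProb a).comp measurable_snd).mul
        ((π.measurable_lastProb a b).comp measurable_snd)).mul ?_
      fun_prop
    -- The last row of the table is independent of the earlier rows, which alone determine the
    -- history before the last pull.
    have hmp := measurePreserving_piFinSuccAbove
      (fun _ : Fin (T + 1) => Measure.pi ν.law) (Fin.last T)
    have : ∫⁻ x, ∑ a, π.pullProb x a * ∑ t, f (x t (a t)) ∂(ν.tableLaw (T + 1)) =
        ∫⁻ z, g z.2 + k z ∂((Measure.pi ν.law).prod (ν.tableLaw T)) := by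
      unfold StochasticInstance.tableLaw
      refine Eq.trans ?_ (hmp.lintegral_comp ((hg.comp measurable_snd).add hk))
      refine lintegral_congr fun x => ?_
      rw [hstep]
      simp [MeasurableEquiv.piFinSuccAbove]
      rfl
    rw [this, lintegral_add_right _ hk]
    have : IsProbabilityMeasure (ν.tableLaw T) := by
      unfold StochasticInstance.tableLaw; infer_instance
    have h1 : ∫⁻ z, g z.2 ∂((Measure.pi ν.law).prod (ν.tableLaw T)) ≤ T * m := by
      have h := lintegral_prod (μ := Measure.pi ν.law) (ν := ν.tableLaw T) (fun z => g z.2)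
        (hg.comp measurable_snd).aemeasurable
      rw [h]
      simpa using ih π.init
    have h2 : ∫⁻ z, k z ∂((Measure.pi ν.law).prod (ν.tableLaw T)) ≤ m := by
      -- With the past fixed, the pull probabilities are constants summing to `1`, so averaging over
      -- the last row gives at most `m`.
      rw [lintegral_prod_symm _ hk.aemeasurable]
      calc _ ≤ ∫⁻ _, m ∂(ν.tableLaw T) := by
            refine lintegral_mono fun x => ?_
            have hfb : ∀ b, ∫⁻ y, f (y b) ∂(Measure.pi ν.law) ≤ m := fun b => by
              rw [(measurePreserving_eval ν.law b).lintegral_comp hf]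
              exact hm b
            simp only [k]
            rw [lintegral_finsetSum _ fun a _ => by fun_prop]
            calc _ = ∑ a : Fin T → Fin K, ∑ b, π.init.pullProb x a * π.lastProb x a b *
                  ∫⁻ y, f (y b) ∂(Measure.pi ν.law) := by
                  refine Finset.sum_congr rfl fun a _ => ?_
                  rw [lintegral_finsetSum _ fun b _ => by fun_prop]
                  refine Finset.sum_congr rfl fun b _ => ?_
                  rw [lintegral_const_mul _ (by fun_prop)]
              _ ≤ ∑ a : Fin T → Fin K, ∑ b, π.init.pullProb x a * π.lastProb x a b * m := by
                  gcongr with a _ b _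
                  exact hfb b
              _ = m := by
                  simp only [← Finset.sum_mul, ← Finset.mul_sum, π.sum_lastProb, mul_one,
                    π.init.sum_pullProb, one_mul]
        _ = m := by simp
    calc _ ≤ T * m + m := add_le_add h1 h2
      _ = _ := by push_cast; ring

end MOBandit

/-! ### Pareto regret against a single leading arm -/

namespace MOBandit

variable {K D : ℕ}

theorem paretoDist_nonneg (p : Fin D → ℝ) (O : Set (Fin D → ℝ)) : 0 ≤ paretoDist p O :=
  Real.sInf_nonneg fun _ h => h.1

/-- An admissible `ε` must exceed some coordinate gap, hence `r`. Two distinct gaps are needed so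
that admissible `ε` exist at all: their midpoint is one. Otherwise the infimum could be the default
`0`. -/
theorem le_paretoDist_singleton {p σ : Fin D → ℝ} {r : ℝ} (hr : ∀ d, r ≤ σ d - p d)
    {c₀ c₁ : Fin D} (hne : σ c₀ - p c₀ ≠ σ c₁ - p c₁) : r ≤ paretoDist p {σ} := by
  rcases le_or_gt r 0 with h0 | h0
  · exact h0.trans (paretoDist_nonneg p _)
  · have h1 := hr c₀
    have h2 := hr c₁
    refine le_csInf ⟨((σ c₀ - p c₀) + (σ c₁ - p c₁)) / 2, by linarith, ?_⟩ ?_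
    · rintro _ rfl
      rcases lt_or_gt_of_ne hne with h | h
      · exact ⟨⟨c₀, by dsimp only; linarith⟩, ⟨c₁, by dsimp only; linarith⟩⟩
      · exact ⟨⟨c₁, by dsimp only; linarith⟩, ⟨c₀, by dsimp only; linarith⟩⟩
    · rintro ε ⟨_, hε⟩
      obtain ⟨⟨d, hd⟩, _⟩ := hε σ rfl
      have := hr d
      dsimp only at hd
      linarith

theorem paretoFront_eq_singleton {T : ℕ} {x : RewardTable K D T} {i : Fin K} (c : Fin D)
    (h : ∀ j, j ≠ i → ∀ d, armTotal x j d < armTotal x i d) :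
    paretoFront x = {armTotal x i} := by
  ext σ
  constructor
  · rintro ⟨j, hj, rfl⟩
    by_cases hji : j = i
    · rw [hji]; rfl
    · obtain ⟨d, hd⟩ := hj i (Ne.symm hji)
      exact absurd hd (h j hji d).le.not_gt
  · rintro rfl
    exact ⟨i, fun j hj => ⟨c, h j hj c⟩, rfl⟩

/-- Suppose that the reward vectors are constant except for a perturbation of size at most `η` in
coordinate `c₀`, that arm `i` leads by more than the perturbations can add up to, and that the
perturbations are generic. Then the Pareto regret is, up to the perturbations, at least the gap
between arm `i` and the player in a coordinate `c₁ ≠ c₀`. -/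
theorem le_paretoRegret {T : ℕ} {x : RewardTable K D T} {c₀ c₁ : Fin D} {η : ℝ} {i : Fin K}
    (hη : 0 ≤ η) (hflat : ∀ t j d, d ≠ c₀ → x t j d = x t j c₁)
    (hpert : ∀ t j k, |(x t j c₀ - x t j c₁) - (x t k c₀ - x t k c₁)| ≤ η)
    (hgap : ∀ j, j ≠ i → armTotal x j c₁ + T * η < armTotal x i c₁)
    (a : Fin T → Fin K)
    (hgen : (∃ t, a t ≠ i) →
      ∑ t, ((x t i c₀ - x t i c₁) - (x t (a t) c₀ - x t (a t) c₁)) ≠ 0) :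
    armTotal x i c₁ - playerTotal x a c₁ - T * η ≤ paretoRegret x a := by
  -- Stated for every `b`, because constant sequences yield the gaps between arms and `a` yields the
  -- gap to the player.
  have key : ∀ b : Fin T → Fin K, ∀ d, armTotal x i c₁ - playerTotal x b c₁ - T * η ≤
      armTotal x i d - playerTotal x b d := by
    intro b d
    have hT : 0 ≤ T * η := by positivity
    by_cases hd : d = c₀
    · have h1 : |∑ t, ((x t i c₀ - x t i c₁) - (x t (b t) c₀ - x t (b t) c₁))| ≤ T * η := by
        refine (Finset.abs_sum_le_sum_abs _ _).trans ?_
        calc _ ≤ ∑ _ : Fin T, η := Finset.sum_le_sum fun t _ => hpert t i (b t)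
          _ = T * η := by simp
      have h2 := (abs_le.1 h1).1
      simp only [Finset.sum_sub_distrib] at h2
      subst hd
      unfold armTotal playerTotal
      linarith
    · have h1 : armTotal x i d = armTotal x i c₁ :=
        Finset.sum_congr rfl fun t _ => hflat t i d hd
      have h2 : playerTotal x b d = playerTotal x b c₁ :=
        Finset.sum_congr rfl fun t _ => hflat t (b t) d hd
      rw [h1, h2]
      linarith
  by_cases hS : ∃ t, a t ≠ i
  · have hfront : paretoFront x = {armTotal x i} := by
      refine paretoFront_eq_singleton c₀ fun j hj d => ?_
      have h1 := key (fun _ => j) d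
      have h2 := hgap j hj
      change armTotal x i c₁ - armTotal x j c₁ - T * η ≤ armTotal x i d - armTotal x j d at h1
      linarith
    unfold paretoRegret
    rw [hfront]
    refine le_paretoDist_singleton (c₀ := c₀) (c₁ := c₁) (key a) fun h => hgen hS ?_
    simp only [Finset.sum_sub_distrib]
    unfold armTotal playerTotal at h
    linarith
  -- A player who always pulls arm `i` has no gap, so the claimed bound is nonpositive.
  · push Not at hS
    have h1 : playerTotal x a c₁ = armTotal x i c₁ :=
      Finset.sum_congr rfl fun t _ => by rw [hS t]
    have hT : 0 ≤ T * η := by positivity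
    refine le_trans ?_ (paretoDist_nonneg _ _)
    linarith

end MOBandit

/-! ### Moments and genericity of sums of independent variables -/

namespace MOBandit

/-- The quartic touches `|z|` at `0` and, tangentially, at `± q`; the difference has the double
factor `(|z| - q) ^ 2`. -/
theorem quartic_le_abs {q : ℝ} (hq : 0 < q) (z : ℝ) :
    3 / (2 * q) * z ^ 2 - 1 / (2 * q ^ 3) * z ^ 4 ≤ |z| := by
  have h : |z| - (3 / (2 * q) * |z| ^ 2 - 1 / (2 * q ^ 3) * |z| ^ 4) =
      |z| * (|z| - q) ^ 2 * (|z| + 2 * q) / (2 * q ^ 3) := by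
    field_simp
    ring
  have h2 : 0 ≤ |z| * (|z| - q) ^ 2 * (|z| + 2 * q) / (2 * q ^ 3) := by positivity
  rw [sq_abs, (by decide : Even 4).pow_abs] at h
  linarith

section Probability

variable {Ω : Type*} [MeasurableSpace Ω] {μ : Measure Ω} [IsProbabilityMeasure μ]

theorem integrable_pow_mul_pow {X Y : Ω → ℝ} (hX : Measurable X) (hY : Measurable Y) {B C : ℝ}
    (hB : ∀ᵐ ω ∂μ, |X ω| ≤ B) (hC : ∀ᵐ ω ∂μ, |Y ω| ≤ C) (m n : ℕ) :
    Integrable (fun ω => X ω ^ m * Y ω ^ n) μ := by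
  refine Integrable.of_bound (by fun_prop) (B ^ m * C ^ n) ?_
  filter_upwards [hB, hC] with ω h1 h2
  have := (abs_nonneg _).trans h1
  rw [Real.norm_eq_abs, abs_mul, abs_pow, abs_pow]
  gcongr

/-- The second moment of a sum of independent, bounded, centered random variables, and a bound of
its fourth moment. -/
theorem moments_sum {ι : Type*} {Y : ι → Ω → ℝ} (hY : ∀ i, Measurable (Y i))
    (hind : iIndepFun Y μ) {C v : ℝ} (hC : ∀ i, ∀ᵐ ω ∂μ, |Y i ω| ≤ C)
    (h1 : ∀ i, ∫ ω, Y i ω ∂μ = 0) (h2 : ∀ i, ∫ ω, Y i ω ^ 2 ∂μ = v)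
    (h4 : ∀ i, ∫ ω, Y i ω ^ 4 ∂μ ≤ 3 * v ^ 2) (s : Finset ι) :
    (∫ ω, ∑ i ∈ s, Y i ω ∂μ = 0) ∧ (∫ ω, (∑ i ∈ s, Y i ω) ^ 2 ∂μ = s.card * v) ∧
      ∫ ω, (∑ i ∈ s, Y i ω) ^ 4 ∂μ ≤ 3 * (s.card * v) ^ 2 := by
  classical
  induction s using Finset.induction_on with
  | empty => simp
  | insert j s hj ih =>
    obtain ⟨e1, e2, e4⟩ := ih
    set S : Ω → ℝ := fun ω => ∑ i ∈ s, Y i ω with hS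
    have hSm : Measurable S := by fun_prop
    have hSb : ∀ᵐ ω ∂μ, |S ω| ≤ s.card * C := by
      have : ∀ᵐ ω ∂μ, ∀ i ∈ s, |Y i ω| ≤ C := (Finset.eventually_all s).2 fun i _ => hC i
      filter_upwards [this] with ω h
      refine (Finset.abs_sum_le_sum_abs _ _).trans ((Finset.sum_le_sum h).trans ?_)
      simp
    have hSY : IndepFun S (Y j) μ := by
      have := hind.indepFun_finsetSum_of_notMem hY hj
      convert this using 1
      ext ω
      simp [hS]
    have hI : ∀ m n, Integrable (fun ω => S ω ^ m * Y j ω ^ n) μ :=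
      integrable_pow_mul_pow hSm (hY j) hSb (hC j)
    have hm : ∀ m n, ∫ ω, S ω ^ m * Y j ω ^ n ∂μ = (∫ ω, S ω ^ m ∂μ) * ∫ ω, Y j ω ^ n ∂μ := by
      intro m n
      have : IndepFun (fun ω => S ω ^ m) (fun ω => Y j ω ^ n) μ :=
        hSY.comp (φ := fun z => z ^ m) (ψ := fun z => z ^ n) (by fun_prop) (by fun_prop)
      exact this.integral_fun_mul_eq_mul_integral (by fun_prop) (by fun_prop)
    have i1 : ∫ ω, S ω ^ 1 ∂μ = 0 := by simpa using e1
    have i1' : ∫ ω, Y j ω ^ 1 ∂μ = 0 := by simpa using h1 j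
    simp only [Finset.sum_insert hj, Finset.card_insert_of_notMem hj]
    refine ⟨?_, ?_, ?_⟩
    · have a1 := hI 0 1
      have a2 := hI 1 0
      simp only [pow_zero, one_mul, pow_one, mul_one] at a1 a2
      rw [integral_add a1 a2, h1 j, zero_add]
      exact e1
    · have : ∀ ω, (Y j ω + S ω) ^ 2 =
          S ω ^ 0 * Y j ω ^ 2 + 2 * (S ω ^ 1 * Y j ω ^ 1) + S ω ^ 2 * Y j ω ^ 0 := fun ω => by ring
      change ∫ ω, (Y j ω + S ω) ^ 2 ∂μ = _
      simp only [this]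
      have J : Integrable (fun ω => S ω ^ 0 * Y j ω ^ 2 + 2 * (S ω ^ 1 * Y j ω ^ 1)) μ :=
        (hI 0 2).add ((hI 1 1).const_mul 2)
      rw [integral_add J (hI 2 0), integral_add (hI 0 2) ((hI 1 1).const_mul 2),
        integral_const_mul, hm, hm, hm, i1, e2, h2]
      simp
      ring
    · have : ∀ ω, (Y j ω + S ω) ^ 4 =
          S ω ^ 0 * Y j ω ^ 4 + 4 * (S ω ^ 1 * Y j ω ^ 3) + 6 * (S ω ^ 2 * Y j ω ^ 2) +
            4 * (S ω ^ 3 * Y j ω ^ 1) + S ω ^ 4 * Y j ω ^ 0 := fun ω => by ring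
      change ∫ ω, (Y j ω + S ω) ^ 4 ∂μ ≤ _
      simp only [this]
      have J1 : Integrable (fun ω => S ω ^ 0 * Y j ω ^ 4 + 4 * (S ω ^ 1 * Y j ω ^ 3)) μ :=
        (hI 0 4).add ((hI 1 3).const_mul 4)
      have J2 : Integrable (fun ω => S ω ^ 0 * Y j ω ^ 4 + 4 * (S ω ^ 1 * Y j ω ^ 3) +
          6 * (S ω ^ 2 * Y j ω ^ 2)) μ := J1.add ((hI 2 2).const_mul 6)
      have J3 : Integrable (fun ω => S ω ^ 0 * Y j ω ^ 4 + 4 * (S ω ^ 1 * Y j ω ^ 3) +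
          6 * (S ω ^ 2 * Y j ω ^ 2) + 4 * (S ω ^ 3 * Y j ω ^ 1)) μ :=
        J2.add ((hI 3 1).const_mul 4)
      rw [integral_add J3 (hI 4 0), integral_add J2 ((hI 3 1).const_mul 4),
        integral_add J1 ((hI 2 2).const_mul 6), integral_add (hI 0 4) ((hI 1 3).const_mul 4),
        integral_const_mul, integral_const_mul, integral_const_mul, hm, hm, hm, hm, hm, i1, i1',
        e2, h2]
      -- The constant `3`, the Gaussian kurtosis, reproduces itself: `3 * (N * v) ^ 2 + 6 * N * v ^
      -- 2 + 3 * v ^ 2 = 3 * ((N + 1) * v) ^ 2` with `N = s.card`.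
      have := h4 j
      simp
      nlinarith

/-- A Khinchin-type lower bound for the first absolute moment of a sum of independent, bounded,
centered random variables. -/
theorem sqrt_le_integral_abs_sum {ι : Type*} {Y : ι → Ω → ℝ} (hY : ∀ i, Measurable (Y i))
    (hind : iIndepFun Y μ) {C v : ℝ} (hv : 0 < v) (hC : ∀ i, ∀ᵐ ω ∂μ, |Y i ω| ≤ C)
    (h1 : ∀ i, ∫ ω, Y i ω ∂μ = 0) (h2 : ∀ i, ∫ ω, Y i ω ^ 2 ∂μ = v)
    (h4 : ∀ i, ∫ ω, Y i ω ^ 4 ∂μ ≤ 3 * v ^ 2) {s : Finset ι} (hs : s.Nonempty) :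
    √(s.card * v / 3) ≤ ∫ ω, |∑ i ∈ s, Y i ω| ∂μ := by
  obtain ⟨-, e2, e4⟩ := moments_sum hY hind hC h1 h2 h4 s
  have hSm : Measurable fun ω => ∑ i ∈ s, Y i ω := by fun_prop
  have hSb : ∀ᵐ ω ∂μ, |∑ i ∈ s, Y i ω| ≤ s.card * C := by
    have : ∀ᵐ ω ∂μ, ∀ i ∈ s, |Y i ω| ≤ C := (Finset.eventually_all s).2 fun i _ => hC i
    filter_upwards [this] with ω h
    refine (Finset.abs_sum_le_sum_abs _ _).trans ((Finset.sum_le_sum h).trans ?_)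
    simp
  have hI : ∀ m, Integrable (fun ω => (∑ i ∈ s, Y i ω) ^ m) μ := fun m => by
    simpa using integrable_pow_mul_pow hSm hSm hSb hSb m 0
  have hV : 0 < s.card * v := by have := hs.card_pos; positivity
  set V := s.card * v
  obtain ⟨r, hr⟩ : ∃ r, r = √(V / 3) := ⟨_, rfl⟩
  have hr0 : 0 < r := by rw [hr]; positivity
  have hr2 : V = 3 * r ^ 2 := by
    have := Real.sq_sqrt (show 0 ≤ V / 3 by positivity)
    rw [← hr] at this
    linarith
  have habs : Integrable (fun ω => |∑ i ∈ s, Y i ω|) μ := by simpa using (hI 1).abs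
  -- The choice `q = 3 * r`, that is `q ^ 2 = 3 * V`, maximizes the resulting bound `3 * V / (2 * q)
  -- - 3 * V ^ 2 / (2 * q ^ 3)`, whose value is then `r`.
  have hmono := integral_mono
    (((hI 2).const_mul (3 / (2 * (3 * r)))).sub ((hI 4).const_mul (1 / (2 * (3 * r) ^ 3)))) habs
    fun ω => quartic_le_abs (q := 3 * r) (by positivity) (∑ i ∈ s, Y i ω)
  rw [← hr]
  refine le_trans ?_ hmono
  simp only [Pi.sub_apply]
  rw [integral_sub ((hI 2).const_mul _) ((hI 4).const_mul _), integral_const_mul,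
    integral_const_mul, e2]
  have : 1 / (2 * (3 * r) ^ 3) * ∫ ω, (∑ i ∈ s, Y i ω) ^ 4 ∂μ ≤
      1 / (2 * (3 * r) ^ 3) * (3 * V ^ 2) := by gcongr
  have e : r = 3 / (2 * (3 * r)) * V - 1 / (2 * (3 * r) ^ 3) * (3 * V ^ 2) := by
    rw [hr2]; field_simp; ring
  linarith

/-- Given the other summands, one atomless independent summand would have to hit a single point. -/
theorem ae_sum_ne_zero {ι : Type*} {ξ : ι → Ω → ℝ} (hξ : ∀ i, Measurable (ξ i))
    (hind : iIndepFun ξ μ) (hna : ∀ i, NullSingletonClass (μ.map (ξ i))) {s : Finset ι}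
    (hs : s.Nonempty) : ∀ᵐ ω ∂μ, ∑ i ∈ s, ξ i ω ≠ 0 := by
  classical
  obtain ⟨j, hj⟩ := hs
  set S : Ω → ℝ := fun ω => ∑ i ∈ s.erase j, ξ i ω with hS
  have hSm : Measurable S := by fun_prop
  have hSY : IndepFun S (ξ j) μ := by
    have := hind.indepFun_finsetSum_of_notMem hξ (Finset.notMem_erase j s)
    convert this using 1
    ext ω
    simp [hS]
  have hprod := (indepFun_iff_map_prod_eq_prod_map_map hSm.aemeasurable (hξ j).aemeasurable).1 hSY
  have hA : MeasurableSet {z : ℝ × ℝ | z.1 + z.2 = 0} :=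
    measurableSet_eq_fun (by fun_prop) (by fun_prop)
  have := Measure.isProbabilityMeasure_map (μ := μ) (hξ j).aemeasurable
  have h0 : ((μ.map S).prod (μ.map (ξ j))) {z : ℝ × ℝ | z.1 + z.2 = 0} = 0 := by
    rw [Measure.measure_prod_null hA]
    refine Filter.Eventually.of_forall fun r => ?_
    have : Prod.mk r ⁻¹' {z : ℝ × ℝ | z.1 + z.2 = 0} = {-r} := by
      ext u
      simp [add_eq_zero_iff_eq_neg']
    simp only [this]
    exact (hna j).measure_singleton _
  rw [← hprod, Measure.map_apply (by fun_prop) hA] at h0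
  rw [ae_iff]
  convert h0 using 2
  ext ω
  simp [hS, Finset.sum_erase_add _ _ hj]

end Probability

end MOBandit

/-! ### The coin flip instance and its almost sure properties -/

namespace MOBandit

/-- The uniform distribution on `[-1, 1]`. -/
noncomputable def uniformSymm : Measure ℝ := (2⁻¹ : ℝ≥0∞) • volume.restrict (Set.Icc (-1) 1)

instance : IsProbabilityMeasure uniformSymm := by
  constructor
  simp only [uniformSymm, Measure.smul_apply, Measure.restrict_apply_univ, Real.volume_Icc,
    smul_eq_mul]
  norm_num
  exact ENNReal.inv_mul_cancel (by simp) (by simp)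

theorem ae_abs_le_one : ∀ᵐ u ∂uniformSymm, |u| ≤ 1 := by
  refine Measure.ae_smul_measure ?_ _
  filter_upwards [ae_restrict_mem measurableSet_Icc] with u hu
  exact abs_le.2 hu

theorem integral_id_uniformSymm : ∫ u, u ∂uniformSymm = 0 := by
  rw [uniformSymm, integral_smul_measure, integral_Icc_eq_integral_Ioc,
    ← intervalIntegral.integral_of_le (by norm_num), integral_id]
  norm_num

/-- A sign, with the value `-1` at `0`. -/
noncomputable def sgn (u : ℝ) : ℝ := if 0 < u then 1 else -1

theorem sgn_eq_or (u : ℝ) : sgn u = 1 ∨ sgn u = -1 := by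
  unfold sgn; split_ifs <;> simp

theorem abs_sgn (u : ℝ) : |sgn u| = 1 := by
  rcases sgn_eq_or u with h | h <;> simp [h]

@[fun_prop]
theorem measurable_sgn : Measurable sgn :=
  Measurable.ite measurableSet_Ioi measurable_const measurable_const

theorem integral_sgn : ∫ u, sgn u ∂uniformSymm = 0 := by
  have h : ∀ u, sgn u = 2 * (Set.Ioi (0 : ℝ)).indicator 1 u - 1 := by
    intro u
    by_cases hu : 0 < u <;> simp [sgn, hu]
    norm_num
  have hm : uniformSymm.real (Set.Ioi 0) = 1 / 2 := by
    have : Set.Ioi (0 : ℝ) ∩ Set.Icc (-1) 1 = Set.Ioc 0 1 := by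
      ext u
      simp only [Set.mem_inter_iff, Set.mem_Ioi, Set.mem_Icc, Set.mem_Ioc]
      constructor
      · rintro ⟨a, b, c⟩; exact ⟨a, c⟩
      · rintro ⟨a, c⟩; exact ⟨a, by linarith, c⟩
    rw [measureReal_def, uniformSymm, Measure.smul_apply, Measure.restrict_apply measurableSet_Ioi,
      this]
    simp
  have hi : Integrable ((Set.Ioi (0 : ℝ)).indicator (1 : ℝ → ℝ)) uniformSymm :=
    (integrable_const (1 : ℝ)).indicator measurableSet_Ioi
  simp only [h]
  rw [integral_sub (hi.const_mul 2) (integrable_const _), integral_const_mul,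
    integral_indicator_one measurableSet_Ioi, hm]
  simp

theorem integrable_sgn : Integrable sgn uniformSymm :=
  Integrable.of_bound (by fun_prop) 1 (.of_forall fun u => (abs_sgn u).le)

theorem integrable_id_uniformSymm : Integrable (fun u : ℝ => u) uniformSymm :=
  Integrable.of_bound (by fun_prop) 1 ae_abs_le_one

/-- The mean reward of arm `i`. -/
noncomputable def armMean (θ : ℝ) (i : Fin 2) : ℝ := 1 / 2 + if i = 1 then θ else 0

/-- The reward vector of arm `i` as a function of a uniform variable `u`: a coin flip `± h` that is
common to all coordinates, and for arm `0` a small continuous perturbation of coordinate `0`. -/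
noncomputable def coinReward (n : ℕ) (h θ : ℝ) (i : Fin 2) (u : ℝ) : Fin (n + 2) → ℝ :=
  fun d => armMean θ i + h * sgn u + (if i = 0 ∧ d = 0 then θ / 2 else 0) * u

variable {n : ℕ} {h θ : ℝ}

theorem measurable_coinReward (i : Fin 2) : Measurable (coinReward n h θ i) := by
  unfold coinReward
  fun_prop

theorem integral_coinReward (i : Fin 2) (d : Fin (n + 2)) :
    ∫ u, coinReward n h θ i u d ∂uniformSymm = armMean θ i := by
  unfold coinReward
  have h1 : Integrable (fun u => armMean θ i + h * sgn u) uniformSymm :=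
    (integrable_const _).add (integrable_sgn.const_mul h)
  rw [integral_add h1 (integrable_id_uniformSymm.const_mul _),
    integral_add (integrable_const _) (integrable_sgn.const_mul h), integral_const_mul,
    integral_const_mul, integral_sgn, integral_id_uniformSymm]
  simp

theorem integrable_coinReward (i : Fin 2) (d : Fin (n + 2)) :
    Integrable (fun u => coinReward n h θ i u d) uniformSymm := by
  unfold coinReward
  exact ((integrable_const _).add (integrable_sgn.const_mul h)).add
    (integrable_id_uniformSymm.const_mul _)

/-- The two-armed instance whose arms flip a fair coin `± h` around means at distance `θ`. -/
noncomputable def coinInstance (n : ℕ) (h θ : ℝ) (hθ : θ ∈ Set.Icc (0 : ℝ) (1 / 2)) :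
    StochasticInstance 2 (n + 2) where
  law i := uniformSymm.map (coinReward n h θ i)
  isProb i := Measure.isProbabilityMeasure_map (measurable_coinReward i).aemeasurable
  integrable_coord i d := by
    rw [integrable_map_measure (measurable_pi_apply d).aestronglyMeasurable
      (measurable_coinReward i).aemeasurable]
    exact integrable_coinReward i d
  mean_mem i d := by
    rw [integral_map (measurable_coinReward i).aemeasurable
      (measurable_pi_apply d).aestronglyMeasurable, integral_coinReward]
    unfold armMean
    obtain ⟨h1, h2⟩ := hθ
    constructor <;> split_ifs <;> linarith

variable {hθ : θ ∈ Set.Icc (0 : ℝ) (1 / 2)}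

theorem coinInstance_mean (i : Fin 2) (d : Fin (n + 2)) :
    (coinInstance n h θ hθ).mean i d = armMean θ i := by
  unfold StochasticInstance.mean coinInstance
  dsimp only
  rw [integral_map (measurable_coinReward i).aemeasurable
      (measurable_pi_apply d).aestronglyMeasurable, integral_coinReward]

/-- The shape of the reward vectors of arm `i`, almost surely. -/
structure IsCoinReward (h θ : ℝ) (i : Fin 2) (v : Fin (n + 2) → ℝ) : Prop where
  flat : ∀ d, d ≠ 0 → v d = v 1
  coin : v 1 = armMean θ i + h ∨ v 1 = armMean θ i - h
  pert : |v 0 - v 1| ≤ if i = 0 then θ / 2 else 0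

theorem measurableSet_isCoinReward (i : Fin 2) :
    MeasurableSet {v : Fin (n + 2) → ℝ | IsCoinReward h θ i v} := by
  have : {v : Fin (n + 2) → ℝ | IsCoinReward h θ i v} =
      (⋂ d, ⋂ _ : d ≠ 0, {v | v d = v 1}) ∩
        ({v | v 1 = armMean θ i + h} ∪ {v | v 1 = armMean θ i - h}) ∩
        {v | |v 0 - v 1| ≤ if i = 0 then θ / 2 else 0} := by
    ext v
    simp only [Set.mem_ofPred_eq, Set.mem_inter_iff, Set.mem_iInter, Set.mem_union]
    exact ⟨fun ⟨a, b, c⟩ => ⟨⟨a, b⟩, c⟩, fun ⟨⟨a, b⟩, c⟩ => ⟨a, b, c⟩⟩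
  rw [this]
  refine ((MeasurableSet.iInter fun d => MeasurableSet.iInter fun _ =>
    measurableSet_eq_fun (by fun_prop) (by fun_prop)).inter
    ((measurableSet_eq_fun (by fun_prop) (by fun_prop)).union
      (measurableSet_eq_fun (by fun_prop) (by fun_prop)))).inter
    (measurableSet_le (by fun_prop) (by fun_prop))

theorem ae_isCoinReward (i : Fin 2) :
    ∀ᵐ v ∂((coinInstance n h θ hθ).law i), IsCoinReward h θ i v := by
  change ∀ᵐ v ∂(uniformSymm.map (coinReward n h θ i)), IsCoinReward h θ i v
  rw [ae_map_iff (measurable_coinReward i).aemeasurable (measurableSet_isCoinReward i)]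
  filter_upwards [ae_abs_le_one] with u hu
  refine ⟨fun d hd => by simp [coinReward, hd], ?_, ?_⟩
  · rcases sgn_eq_or u with hs | hs
    · left; simp [coinReward, hs]
    · right; simp [coinReward, hs, sub_eq_add_neg]
  · have h0 := hθ.1
    by_cases hi : i = 0
    · simp only [coinReward, hi]
      simp only [Fin.isValue, and_self, if_true, one_ne_zero, and_false, if_false]
      rw [show ∀ a : ℝ, a + θ / 2 * u - (a + 0 * u) = θ / 2 * u by intro a; ring, abs_mul,
        abs_of_nonneg (by positivity)]
      exact mul_le_of_le_one_right (by positivity) hu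
    · simp [coinReward, hi]

instance {K D : ℕ} (ν : StochasticInstance K D) (T : ℕ) :
    IsProbabilityMeasure (ν.tableLaw T) := by
  unfold StochasticInstance.tableLaw; infer_instance

theorem measurePreserving_row {K D T : ℕ} (ν : StochasticInstance K D) (t : Fin T) :
    MeasurePreserving (fun x : RewardTable K D T => x t) (ν.tableLaw T) (Measure.pi ν.law) :=
  measurePreserving_eval (fun _ : Fin T => Measure.pi ν.law) t

theorem measurePreserving_entry {K D T : ℕ} (ν : StochasticInstance K D) (t : Fin T) (i : Fin K) :
    MeasurePreserving (fun x : RewardTable K D T => x t i) (ν.tableLaw T) (ν.law i) :=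
  (measurePreserving_eval ν.law i).comp (measurePreserving_row ν t)

theorem iIndepFun_row {K D T : ℕ} (ν : StochasticInstance K D) {g : (Fin K → Fin D → ℝ) → ℝ}
    (hg : Measurable g) :
    iIndepFun (fun t (x : RewardTable K D T) => g (x t)) (ν.tableLaw T) :=
  iIndepFun_pi (μ := fun _ : Fin T => Measure.pi ν.law) (X := fun _ => g)
    fun _ => hg.aemeasurable

theorem ae_forall_isCoinReward (T : ℕ) : ∀ᵐ x ∂((coinInstance n h θ hθ).tableLaw T),
    ∀ t i, IsCoinReward h θ i (x t i) := by
  rw [ae_all_iff]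
  intro t
  rw [ae_all_iff]
  intro i
  exact (measurePreserving_entry (coinInstance n h θ hθ) t i).quasiMeasurePreserving.ae
    (ae_isCoinReward i)

/-- `S` will be the set of steps at which the player deviates from the leading arm. It depends on
the rewards, so all of the finitely many `S` are treated simultaneously. -/
theorem ae_perturbation_sum_ne_zero (hpos : 0 < θ) (T : ℕ) :
    ∀ᵐ x ∂((coinInstance n h θ hθ).tableLaw T),
      ∀ S : Finset (Fin T), S.Nonempty → ∑ t ∈ S, (x t 0 0 - x t 0 1) ≠ 0 := by
  rw [ae_all_iff]
  intro S
  by_cases hS : S.Nonempty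
  swap
  · exact .of_forall fun x hx => absurd hx hS
  have hind := iIndepFun_row (T := T) (coinInstance n h θ hθ)
    (g := fun y => y 0 0 - y 0 1) (by fun_prop)
  have := ae_sum_ne_zero (fun t => by fun_prop) hind (fun t => ?_) hS
  · filter_upwards [this] with x hx _ using hx
  · have hmp := measurePreserving_entry (coinInstance n h θ hθ) t 0
    have e : ((coinInstance n h θ hθ).tableLaw T).map (fun x => x t 0 0 - x t 0 1) =
        uniformSymm.map fun u => θ / 2 * u := by
      have e1 : (fun x : RewardTable 2 (n + 2) T => x t 0 0 - x t 0 1) =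
        (fun v => v 0 - v 1) ∘ fun x => x t 0 := rfl
      rw [e1, ← Measure.map_map (by fun_prop) hmp.measurable, hmp.map_eq]
      change (uniformSymm.map (coinReward n h θ 0)).map _ = _
      rw [Measure.map_map (by fun_prop) (measurable_coinReward 0)]
      congr 1
      ext u
      simp [coinReward]
    rw [e]
    refine ⟨fun r => ?_⟩
    rw [Measure.map_apply (by fun_prop) (measurableSet_singleton r)]
    have : (fun u => θ / 2 * u) ⁻¹' {r} = {r / (θ / 2)} := by
      ext u
      simp only [Set.mem_preimage, Set.mem_singleton_iff]
      rw [eq_div_iff (by positivity), mul_comm]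
    rw [this]
    simp [uniformSymm]

/-- Almost surely, the Pareto regret of every sequence of pulls is at least the gap to the better
arm in coordinate `1`, up to the perturbations. -/
theorem ae_le_paretoRegret (hpos : 0 < θ) {T : ℕ} (hT : 0 < T) (hTθ : T * θ < h) :
    ∀ᵐ x ∂((coinInstance n h θ hθ).tableLaw T), ∀ a : Fin T → Fin 2,
      max (armTotal x 0 1) (armTotal x 1 1) - playerTotal x a 1 - T * (θ / 2) ≤
        paretoRegret x a := by
  filter_upwards [ae_forall_isCoinReward T, ae_perturbation_sum_ne_zero hpos T] with x hx hne a
  have hTr : (0 : ℝ) < T := by exact_mod_cast hT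
  have hp := mul_pos hTr hpos
  have hflat : ∀ t j d, d ≠ 0 → x t j d = x t j 1 := fun t j => (hx t j).flat
  have h1 : ∀ t, x t 1 0 - x t 1 1 = 0 := fun t => by simpa using (hx t 1).pert
  have h0 : ∀ t, |x t 0 0 - x t 0 1| ≤ θ / 2 := fun t => by simpa using (hx t 0).pert
  have hpert : ∀ t j k, |(x t j 0 - x t j 1) - (x t k 0 - x t k 1)| ≤ θ / 2 := by
    intro t j k
    have := h0 t
    have := abs_sub_comm (x t 0 1) (x t 0 0) ▸ h0 t
    fin_cases j <;> fin_cases k <;> simp [*] <;> linarith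
  -- The lattice structure rules out ties between the totals.
  have hk : ∀ t, ∃ k : ℤ, x t 0 1 - x t 1 1 = 2 * h * k - θ := by
    intro t
    have e0 : armMean θ 0 = 1 / 2 := by simp [armMean]
    have e1 : armMean θ 1 = 1 / 2 + θ := by simp [armMean]
    rcases (hx t 0).coin with c | c <;> rcases (hx t 1).coin with c' | c' <;>
      rw [c, c', e0, e1]
    · exact ⟨0, by push_cast; ring⟩
    · exact ⟨1, by push_cast; ring⟩
    · exact ⟨-1, by push_cast; ring⟩
    · exact ⟨0, by push_cast; ring⟩
  choose k hk using hk
  have hdiff : armTotal x 0 1 - armTotal x 1 1 = 2 * h * ((∑ t, k t : ℤ) : ℝ) - T * θ := by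
    unfold armTotal
    rw [← Finset.sum_sub_distrib, Finset.sum_congr rfl fun t _ => hk t]
    push_cast
    simp [Finset.mul_sum]
  have hη : 0 ≤ θ / 2 := by positivity
  -- For a nonpositive sum arm `1` leads by at least `T * θ`; otherwise arm `0` leads by at least `2
  -- * h - T * θ > T * θ`. Both leads exceed the total perturbation `T * (θ / 2)`.
  rcases le_or_gt (∑ t, k t) 0 with hle | hlt
  · have hle' : ((∑ t, k t : ℤ) : ℝ) ≤ 0 := by exact_mod_cast hle
    have hlt : armTotal x 0 1 + T * (θ / 2) < armTotal x 1 1 := by nlinarith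
    rw [max_eq_right (by nlinarith)]
    refine le_paretoRegret (c₀ := 0) (i := 1) hη hflat hpert ?_ a ?_
    · intro j hj
      fin_cases j
      · exact hlt
      · exact absurd rfl hj
    · rintro ⟨t, ht⟩ hsum
      -- Arm `1` is unperturbed, so only the steps with a pull of arm `0` contribute, with a minus
      -- sign.
      refine hne (Finset.univ.filter fun t => a t ≠ 1) ⟨t, by simpa using ht⟩ ?_
      rw [Finset.sum_filter, ← neg_eq_zero, ← Finset.sum_neg_distrib]
      refine Eq.trans (Finset.sum_congr rfl fun s _ => ?_) hsum
      by_cases hs : a s = 1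
      · simp [hs]
      · have : a s = 0 := by omega
        simp [this, h1]
  · have hlt' : (1 : ℝ) ≤ ((∑ t, k t : ℤ) : ℝ) := by exact_mod_cast hlt
    have hlt : armTotal x 1 1 + T * (θ / 2) < armTotal x 0 1 := by nlinarith
    rw [max_eq_left (by nlinarith)]
    refine le_paretoRegret (c₀ := 0) (i := 0) hη hflat hpert ?_ a ?_
    · intro j hj
      fin_cases j
      · exact absurd rfl hj
      · exact hlt
    · rintro ⟨t, ht⟩ hsum
      refine hne (Finset.univ.filter fun t => a t ≠ 0) ⟨t, by simpa using ht⟩ ?_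
      rw [Finset.sum_filter]
      refine Eq.trans (Finset.sum_congr rfl fun s _ => ?_) hsum
      by_cases hs : a s = 0
      · simp [hs]
      · have : a s = 1 := by omega
        simp [this, h1]

end MOBandit

/-! ### Fluctuation of the better total and the regret bound -/

namespace MOBandit

variable {n : ℕ} {h θ : ℝ} {hθ : θ ∈ Set.Icc (0 : ℝ) (1 / 2)}

/-- The centered reward of arm `i` in coordinate `1`. -/
noncomputable def centered (θ : ℝ) (i : Fin 2) (y : Fin 2 → Fin (n + 2) → ℝ) : ℝ :=
  y i 1 - armMean θ i

theorem measurable_centered (i : Fin 2) : Measurable (centered (n := n) θ i) := by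
  unfold centered
  fun_prop

theorem ae_centered_sq (i : Fin 2) :
    ∀ᵐ y ∂(Measure.pi (coinInstance n h θ hθ).law), centered θ i y ^ 2 = h ^ 2 := by
  have := (measurePreserving_eval (coinInstance n h θ hθ).law i).quasiMeasurePreserving.ae
    (ae_isCoinReward i)
  filter_upwards [this] with y hy
  rcases hy.coin with e | e <;> simp only [centered, Function.eval] at e ⊢ <;> rw [e] <;> ring

theorem integral_centered (i : Fin 2) :
    ∫ y, centered θ i y ∂(Measure.pi (coinInstance n h θ hθ).law) = 0 := by
  have e := integral_comp_eval (μ := (coinInstance n h θ hθ).law) (i := i)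
    (f := fun v => v 1 - armMean θ i)
    (Measurable.aestronglyMeasurable (by fun_prop))
  refine Eq.trans e ?_
  rw [integral_sub ((coinInstance n h θ hθ).integrable_coord i 1) (integrable_const _)]
  have := coinInstance_mean (h := h) (hθ := hθ) i (1 : Fin (n + 2))
  unfold StochasticInstance.mean at this
  rw [this]
  simp

theorem ae_abs_centered (hh : 0 ≤ h) (i : Fin 2) :
    ∀ᵐ y ∂(Measure.pi (coinInstance n h θ hθ).law), |centered θ i y| ≤ h := by
  filter_upwards [ae_centered_sq i] with y hy
  exact abs_le_of_sq_le_sq hy.le hh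

theorem integral_centered_mul :
    ∫ y, centered θ 0 y * centered θ 1 y ∂(Measure.pi (coinInstance n h θ hθ).law) = 0 := by
  have hind := iIndepFun_pi (μ := (coinInstance n h θ hθ).law)
    (X := fun i v => v 1 - armMean θ i) fun i => Measurable.aemeasurable (by fun_prop)
  have := (hind.indepFun (show (0 : Fin 2) ≠ 1 by decide)).integral_fun_mul_eq_mul_integral
    (Measurable.aestronglyMeasurable (by fun_prop))
    (Measurable.aestronglyMeasurable (by fun_prop))
  refine this.trans ?_
  rw [show ∫ y, y 0 1 - armMean θ 0 ∂(Measure.pi (coinInstance n h θ hθ).law) = 0 from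
    integral_centered 0, zero_mul]

theorem integrable_centered (hh : 0 ≤ h) (i : Fin 2) :
    Integrable (centered θ i) (Measure.pi (coinInstance n h θ hθ).law) :=
  Integrable.of_bound (measurable_centered i).aestronglyMeasurable h (ae_abs_centered hh i)

theorem integrable_centered_mul (hh : 0 ≤ h) :
    Integrable (fun y => centered θ 0 y * centered θ 1 y)
      (Measure.pi (coinInstance n h θ hθ).law) := by
  simpa using integrable_pow_mul_pow (measurable_centered 0) (measurable_centered 1)
    (ae_abs_centered hh 0) (ae_abs_centered hh 1) 1 1

theorem integral_centered_sub_sq (hh : 0 ≤ h) :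
    ∫ y, (centered θ 0 y - centered θ 1 y) ^ 2 ∂(Measure.pi (coinInstance n h θ hθ).law) =
      2 * h ^ 2 := by
  have : ∀ᵐ y ∂(Measure.pi (coinInstance n h θ hθ).law),
      (centered θ 0 y - centered θ 1 y) ^ 2 =
        2 * h ^ 2 - 2 * (centered θ 0 y * centered θ 1 y) := by
    filter_upwards [ae_centered_sq 0, ae_centered_sq 1] with y h0 h1
    linear_combination h0 + h1
  rw [integral_congr_ae this,
    integral_sub (integrable_const _) ((integrable_centered_mul hh).const_mul 2),
    integral_const_mul, integral_const_mul, integral_centered_mul]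
  simp

theorem integral_centered_sub_pow_four (hh : 0 ≤ h) :
    ∫ y, (centered θ 0 y - centered θ 1 y) ^ 4 ∂(Measure.pi (coinInstance n h θ hθ).law) =
      8 * h ^ 4 := by
  have : ∀ᵐ y ∂(Measure.pi (coinInstance n h θ hθ).law),
      (centered θ 0 y - centered θ 1 y) ^ 4 =
        8 * h ^ 4 - 8 * h ^ 2 * (centered θ 0 y * centered θ 1 y) := by
    filter_upwards [ae_centered_sq 0, ae_centered_sq 1] with y h0 h1
    have e : (centered θ 0 y - centered θ 1 y) ^ 4 =
        (centered θ 0 y ^ 2 + centered θ 1 y ^ 2) ^ 2 + 4 * (centered θ 0 y ^ 2 *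
          centered θ 1 y ^ 2) - 4 * (centered θ 0 y ^ 2 + centered θ 1 y ^ 2) *
            (centered θ 0 y * centered θ 1 y) := by ring
    rw [e, h0, h1]
    ring
  rw [integral_congr_ae this,
    integral_sub (integrable_const _) ((integrable_centered_mul hh).const_mul _),
    integral_const_mul, integral_const_mul, integral_centered_mul]
  simp

/-- The centered difference of the cumulative rewards of the two arms in coordinate `1`. -/
noncomputable def centeredGap {T : ℕ} (θ : ℝ) (x : RewardTable 2 (n + 2) T) : ℝ :=
  ∑ t, (centered θ 0 (x t) - centered θ 1 (x t))

theorem centeredGap_eq {T : ℕ} (x : RewardTable 2 (n + 2) T) :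
    centeredGap θ x = armTotal x 0 1 - armTotal x 1 1 + T * θ := by
  have : ∀ t, centered θ 0 (x t) - centered θ 1 (x t) = x t 0 1 - x t 1 1 + θ := fun t => by
    simp only [centered, armMean]
    simp
    ring
  simp [centeredGap, this, armTotal, Finset.sum_add_distrib]

theorem integrable_entry (T : ℕ) (t : Fin T) (i : Fin 2) :
    Integrable (fun x : RewardTable 2 (n + 2) T => x t i 1)
      ((coinInstance n h θ hθ).tableLaw T) :=
  (measurePreserving_entry (coinInstance n h θ hθ) t i).integrable_comp_of_integrable
    ((coinInstance n h θ hθ).integrable_coord i 1)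

theorem integral_entry (T : ℕ) (t : Fin T) (i : Fin 2) :
    ∫ x : RewardTable 2 (n + 2) T, x t i 1 ∂((coinInstance n h θ hθ).tableLaw T) =
      armMean θ i := by
  have hmp := measurePreserving_entry (coinInstance n h θ hθ) t i
  rw [← coinInstance_mean (h := h) (hθ := hθ) i (1 : Fin (n + 2)), StochasticInstance.mean,
    ← hmp.map_eq, integral_map hmp.aemeasurable (measurable_pi_apply _).aestronglyMeasurable]

theorem integrable_armTotal (T : ℕ) (i : Fin 2) :
    Integrable (fun x : RewardTable 2 (n + 2) T => armTotal x i 1)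
      ((coinInstance n h θ hθ).tableLaw T) :=
  integrable_finsetSum _ fun t _ => integrable_entry T t i

theorem integral_armTotal (T : ℕ) (i : Fin 2) :
    ∫ x : RewardTable 2 (n + 2) T, armTotal x i 1 ∂((coinInstance n h θ hθ).tableLaw T) =
      T * armMean θ i := by
  unfold armTotal
  rw [integral_finsetSum _ fun t _ => integrable_entry T t i]
  simp [integral_entry]

theorem integrable_centeredGap (T : ℕ) :
    Integrable (fun x : RewardTable 2 (n + 2) T => centeredGap θ x)
      ((coinInstance n h θ hθ).tableLaw T) := by
  simp only [centeredGap_eq]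
  exact ((integrable_armTotal T 0).sub (integrable_armTotal T 1)).add (integrable_const _)

theorem integral_centeredGap (T : ℕ) :
    ∫ x : RewardTable 2 (n + 2) T, centeredGap θ x ∂((coinInstance n h θ hθ).tableLaw T) = 0 := by
  simp only [centeredGap_eq]
  have hi : Integrable (fun x : RewardTable 2 (n + 2) T => armTotal x 0 1 - armTotal x 1 1)
      ((coinInstance n h θ hθ).tableLaw T) := (integrable_armTotal T 0).sub (integrable_armTotal T 1)
  rw [integral_add hi (integrable_const _),
    integral_sub (integrable_armTotal T 0) (integrable_armTotal T 1), integral_armTotal,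
    integral_armTotal]
  simp [armMean]
  ring

theorem sqrt_le_integral_abs_centeredGap (hh : 0 < h) {T : ℕ} (hT : 0 < T) :
    2 * h * √(T / 6) ≤
      ∫ x : RewardTable 2 (n + 2) T, |centeredGap θ x| ∂((coinInstance n h θ hθ).tableLaw T) := by
  set ν := coinInstance n h θ hθ
  have hm : Measurable fun y : Fin 2 → Fin (n + 2) → ℝ => centered θ 0 y - centered θ 1 y :=
    (measurable_centered 0).sub (measurable_centered 1)
  have hrow : ∀ (t : Fin T) (g : ℝ → ℝ), Measurable g →
      ∫ x : RewardTable 2 (n + 2) T, g (centered θ 0 (x t) - centered θ 1 (x t)) ∂(ν.tableLaw T) =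
        ∫ y, g (centered θ 0 y - centered θ 1 y) ∂(Measure.pi ν.law) := by
    intro t g hg
    have hmp := measurePreserving_row ν t
    rw [← hmp.map_eq]
    exact (integral_map hmp.aemeasurable (hg.comp hm).aestronglyMeasurable).symm
  have key := sqrt_le_integral_abs_sum (μ := ν.tableLaw T)
    (Y := fun t x => centered θ 0 (x t) - centered θ 1 (x t)) (C := 2 * h) (v := 2 * h ^ 2)
    (s := Finset.univ) (fun t => hm.comp (measurable_pi_apply t)) (iIndepFun_row ν hm)
    (by positivity) ?_ ?_ ?_ ?_ ⟨⟨0, hT⟩, Finset.mem_univ _⟩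
  · refine le_trans (le_of_eq ?_) key
    rw [Finset.card_univ, Fintype.card_fin,
      show (T : ℝ) * (2 * h ^ 2) / 3 = (2 * h) ^ 2 * (T / 6) by ring,
      Real.sqrt_mul (by positivity), Real.sqrt_sq (by positivity)]
  · intro t
    refine (measurePreserving_row ν t).quasiMeasurePreserving.ae
      (p := fun y => |centered θ 0 y - centered θ 1 y| ≤ 2 * h) ?_
    filter_upwards [ae_abs_centered hh.le 0, ae_abs_centered hh.le 1] with y h0 h1
    refine (abs_sub _ _).trans ?_
    linarith
  · intro t
    refine (hrow t id measurable_id).trans ?_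
    simp only [id]
    rw [integral_sub (integrable_centered hh.le 0) (integrable_centered hh.le 1),
      integral_centered, integral_centered, sub_zero]
  · intro t
    exact (hrow t (fun z => z ^ 2) (by fun_prop)).trans (integral_centered_sub_sq hh.le)
  · intro t
    refine ((hrow t (fun z => z ^ 4) (by fun_prop)).trans
      (integral_centered_sub_pow_four hh.le)).le.trans ?_
    -- `8 * h ^ 4 ≤ 3 * (2 * h ^ 2) ^ 2 = 12 * h ^ 4`.
    nlinarith [sq_nonneg (h ^ 2)]

/-- A lower bound for the expected Pareto regret of every algorithm on a coin flip instance. -/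
theorem le_expectedParetoRegret (hpos : 0 < θ) {T : ℕ} (hT : 0 < T) (hTθ : T * θ < h)
    (π : RandomizedAlgorithm 2 (n + 2) T) {c : ℝ} (hc : 0 ≤ c)
    (hlt : c < h * √(T / 6) - 3 / 2 * (T * θ)) :
    ENNReal.ofReal c < expectedParetoRegret (coinInstance n h θ hθ) π := by
  have hTr : (0 : ℝ) < T := by exact_mod_cast hT
  have hTp := mul_pos hTr hpos
  have hh : 0 < h := hTp.trans hTθ
  set ν := coinInstance n h θ hθ
  -- The least value of the rewards in coordinate `1`; subtracting it allows integration in `[0,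
  -- ∞]`.
  let L : ℝ := 1 / 2 - h
  let f : (Fin (n + 2) → ℝ) → ℝ≥0∞ := fun v => ENNReal.ofReal (v 1 - L)
  have hf : Measurable f := by fun_prop
  have e0 : armMean θ 0 = 1 / 2 := by simp [armMean]
  have e1 : armMean θ 1 = 1 / 2 + θ := by simp [armMean]
  have hmean : ∀ i, armMean θ i ∈ Set.Icc (1 / 2) (1 / 2 + θ) := by
    intro i
    fin_cases i
    · simp only [Fin.zero_eta, e0]; exact ⟨le_rfl, by linarith⟩
    · simp only [Fin.mk_one, e1]; exact ⟨by linarith, le_rfl⟩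
  have hcoin : ∀ {i} {v : Fin (n + 2) → ℝ}, IsCoinReward h θ i v → L ≤ v 1 := by
    intro i v hv
    have := (hmean i).1
    rcases hv.coin with e | e <;> rw [e] <;> simp only [L] <;> linarith
  have hm : ∀ i, ∫⁻ v, f v ∂(ν.law i) ≤ ENNReal.ofReal (θ + h) := by
    intro i
    have hi := ν.integrable_coord i 1
    have hiL : Integrable (fun v : Fin (n + 2) → ℝ => v 1 - L) (ν.law i) :=
      hi.sub (integrable_const L)
    rw [← ofReal_integral_eq_lintegral_ofReal hiL]
    · refine ENNReal.ofReal_le_ofReal ?_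
      have e : ∫ v, v 1 ∂(ν.law i) = armMean θ i := coinInstance_mean i 1
      rw [integral_sub hi (integrable_const L), e]
      have := (hmean i).2
      simp only [integral_const, probReal_univ, one_smul, L]
      linarith
    · filter_upwards [ae_isCoinReward i] with v hv
      exact sub_nonneg.2 (hcoin hv)
  have hplayer := lintegral_collected_le ν hf hm π
  let G : RewardTable 2 (n + 2) T → ℝ :=
    fun x => max (armTotal x 0 1) (armTotal x 1 1) - T * L - T * (θ / 2)
  have hpoint : ∀ᵐ x ∂(ν.tableLaw T), ENNReal.ofReal (G x) ≤
      ∑ a, π.pullProb x a * ENNReal.ofReal (paretoRegret x a) +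
        ∑ a, π.pullProb x a * ∑ t, f (x t (a t)) := by
    filter_upwards [ae_forall_isCoinReward T, ae_le_paretoRegret hpos hT hTθ] with x hx hreg
    rw [← Finset.sum_add_distrib]
    calc ENNReal.ofReal (G x) = ∑ a, π.pullProb x a * ENNReal.ofReal (G x) := by
          rw [← Finset.sum_mul, π.sum_pullProb, one_mul]
      _ ≤ _ := by
          refine Finset.sum_le_sum fun a _ => ?_
          rw [← mul_add]
          gcongr
          have hnn : ∀ t, 0 ≤ x t (a t) 1 - L := fun t => sub_nonneg.2 (hcoin (hx t (a t)))
          simp only [f]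
          rw [← ENNReal.ofReal_sum_of_nonneg fun t _ => hnn t,
            ← ENNReal.ofReal_add (show 0 ≤ paretoRegret x a from paretoDist_nonneg _ _)
              (Finset.sum_nonneg fun t _ => hnn t)]
          refine ENNReal.ofReal_le_ofReal ?_
          have := hreg a
          have e : ∑ t, (x t (a t) 1 - L) = playerTotal x a 1 - T * L := by
            simp [playerTotal]
          rw [e]
          simp only [G]
          linarith
  have hGi : Integrable G (ν.tableLaw T) :=
    (((integrable_armTotal T 0).sup (integrable_armTotal T 1)).sub (integrable_const _)).sub
      (integrable_const _)
  have hGnn : 0 ≤ᵐ[ν.tableLaw T] G := by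
    filter_upwards [ae_forall_isCoinReward T] with x hx
    have h1 : (T : ℝ) * (L + θ) ≤ armTotal x 1 1 := by
      have : ∀ t, L + θ ≤ x t 1 1 := by
        intro t
        rcases (hx t 1).coin with e | e <;> rw [e, e1] <;> simp only [L] <;> linarith
      calc (T : ℝ) * (L + θ) = ∑ _ : Fin T, (L + θ) := by simp [mul_add]
        _ ≤ _ := Finset.sum_le_sum fun t _ => this t
    have h2 := le_max_right (armTotal x 0 1) (armTotal x 1 1)
    simp only [G, Pi.zero_apply]
    nlinarith
  have hGint : T * (h - θ / 2) + h * √(T / 6) ≤ ∫ x, G x ∂(ν.tableLaw T) := by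
    have hgap := sqrt_le_integral_abs_centeredGap (n := n) (θ := θ) (hθ := hθ) hh hT
    have i1 := integrable_armTotal (n := n) (h := h) (hθ := hθ) T 1
    have i2 := (integrable_centeredGap (n := n) (h := h) (hθ := hθ) T)
    have i3 : Integrable (fun x : RewardTable 2 (n + 2) T =>
        armTotal x 1 1 + 1 / 2 * centeredGap θ x) (ν.tableLaw T) := i1.add (i2.const_mul (1 / 2))
    have i4 : Integrable (fun x : RewardTable 2 (n + 2) T => armTotal x 1 1 +
        1 / 2 * centeredGap θ x + 1 / 2 * |centeredGap θ x|) (ν.tableLaw T) :=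
      i3.add (i2.abs.const_mul (1 / 2))
    -- The maximum is the total of arm `1` plus the positive part of the difference. Centering that
    -- difference costs at most `T * θ`; the other `T * θ / 2` comes from the perturbations in `G`.
    have hle : ∀ x, armTotal x 1 1 + 1 / 2 * centeredGap θ x + 1 / 2 * |centeredGap θ x| -
        (3 / 2 * (T * θ) + T * L) ≤ G x := by
      intro x
      have e := centeredGap_eq (θ := θ) x
      have := le_max_left (armTotal x 0 1) (armTotal x 1 1)
      have := le_max_right (armTotal x 0 1) (armTotal x 1 1)
      simp only [G]
      rcases abs_cases (centeredGap θ x) with ⟨c, _⟩ | ⟨c, _⟩ <;> rw [c] <;> linarith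
    have := integral_mono (i4.sub (integrable_const (3 / 2 * (T * θ) + T * L))) hGi hle
    refine le_trans ?_ this
    simp only [Pi.sub_apply]
    rw [integral_sub i4 (integrable_const _), integral_add i3 (i2.abs.const_mul (1 / 2)),
      integral_add i1 (i2.const_mul (1 / 2)), integral_const_mul, integral_const_mul,
      integral_armTotal, integral_centeredGap, e1]
    simp only [integral_const, probReal_univ, one_smul, L]
    linarith
  have hmain : ENNReal.ofReal (∫ x, G x ∂(ν.tableLaw T)) ≤
      expectedParetoRegret ν π + T * ENNReal.ofReal (θ + h) := by
    rw [ofReal_integral_eq_lintegral_ofReal hGi hGnn]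
    refine (lintegral_mono_ae hpoint).trans ?_
    rw [lintegral_add_right]
    · exact add_le_add le_rfl hplayer
    · refine Finset.measurable_sum _ fun a _ => (π.measurable_pullProb a).mul ?_
      fun_prop
  by_contra! hcon
  have h3 : ENNReal.ofReal (∫ x, G x ∂(ν.tableLaw T)) ≤ ENNReal.ofReal (c + T * (θ + h)) := by
    rw [ENNReal.ofReal_add hc (by positivity), ENNReal.ofReal_mul hTr.le, ENNReal.ofReal_natCast]
    exact hmain.trans (add_le_add hcon le_rfl)
  have h4 := (ENNReal.ofReal_le_ofReal_iff (by positivity)).1 h3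
  nlinarith

end MOBandit

/-! ### Numerical comparison with the logarithm -/

namespace MOBandit

/-- Tangent line of the logarithm in the variable `√x` at `x = 16`; the constant rounds up `4 * log
2 - 2`. -/
theorem log_le_sqrt {x : ℝ} (hx : 0 < x) : Real.log x ≤ 0.7726 + √x / 2 := by
  have h1 := Real.log_le_sub_one_of_pos (show 0 < √x / 4 by positivity)
  have h16 : Real.log 16 = 4 * Real.log 2 := by
    rw [show (16 : ℝ) = 2 ^ 4 by norm_num, Real.log_pow]; norm_num
  have h2 : Real.log x = 4 * Real.log 2 + 2 * Real.log (√x / 4) := by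
    have : x = 16 * (√x / 4) ^ 2 := by rw [div_pow, Real.sq_sqrt hx.le]; ring
    conv_lhs => rw [this]
    rw [Real.log_mul (by norm_num) (by positivity), Real.log_pow, h16]
    norm_num
  have := Real.log_two_lt_d9
  linarith

/-- Up to terms in `θ`, dividing by `κ` leaves `0.7726 + r / 2 < 0.816 * r` with `r = √T ≥ 3.46`.
The upper bound on `T` keeps the terms in `θ` below the slack. -/
theorem log_lt_of_horizon {κ h θ : ℝ} (hκ : 1 / 4 ≤ κ) (hθ : θ = 1 / 1000000)
    (hh : h = 2 * κ - θ) {T : ℕ} (h11 : 11 < T) (h1200 : T ≤ 1200) :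
    κ * Real.log T < h * √(T / 6) - 3 / 2 * (T * θ) := by
  have hT1 : (12 : ℝ) ≤ T := by exact_mod_cast h11
  have hT2 : (T : ℝ) ≤ 1200 := by exact_mod_cast h1200
  have hlog := log_le_sqrt (show (0 : ℝ) < T by linarith)
  set r := √(T : ℝ) with hr
  have hr1 : 3.46 ≤ r := Real.le_sqrt_of_sq_le (by linarith)
  have hsq : 0.408 * r ≤ √(T / 6) := by
    refine Real.le_sqrt_of_sq_le ?_
    rw [mul_pow, hr, Real.sq_sqrt (by linarith)]
    linarith
  have hh0 : 0 ≤ h := by rw [hh, hθ]; linarith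
  have a1 : h * (0.408 * r) ≤ h * √(T / 6) := by gcongr
  have a2 : κ * Real.log T ≤ κ * (0.7726 + r / 2) := by gcongr
  have a3 : (T : ℝ) * θ ≤ 0.0012 := by rw [hθ]; linarith
  have hr2 : r ≤ 35 := by
    rw [hr, Real.sqrt_le_left (by norm_num)]
    linarith
  rw [hh, hθ] at a1
  nlinarith

end MOBandit

theorem theorem6 (D : ℕ) (hD : 2 ≤ D) :
    (∃ ν : MOBandit.StochasticInstance 2 D,
      (∃ m : Fin 2 → ℝ, m 0 < m 1 ∧ ∀ i d, ν.mean i d = m i) ∧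
      (∀ i, ∀ᵐ v ∂(ν.law i), ∀ d, v d ∈ Set.Icc (0 : ℝ) 1) ∧
      ∀ T : ℕ, 11 < T → T ≤ 1200 → ∀ π : MOBandit.RandomizedAlgorithm 2 D T,
        ENNReal.ofReal (1 / 4 * Real.log T) < MOBandit.expectedParetoRegret ν π) ∧
    (∃ ν : MOBandit.StochasticInstance 2 D,
      (∃ m : Fin 2 → ℝ, m 0 < m 1 ∧ ∀ i d, ν.mean i d = m i) ∧
      (∀ i, ∀ᵐ v ∂(ν.law i), ∀ d, |v d - ν.mean i d| ≤ 2) ∧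
      ∀ T : ℕ, 11 < T → T ≤ 1200 → ∀ π : MOBandit.RandomizedAlgorithm 2 D T,
        ENNReal.ofReal (Real.log T) < MOBandit.expectedParetoRegret ν π) := by
  obtain ⟨n, rfl⟩ : ∃ n, D = n + 2 := ⟨D - 2, by omega⟩
  obtain ⟨θ, hθ⟩ : ∃ θ : ℝ, θ = 1 / 1000000 := ⟨_, rfl⟩
  have hθI : θ ∈ Set.Icc (0 : ℝ) (1 / 2) := by constructor <;> rw [hθ] <;> norm_num
  have hpos : 0 < θ := by rw [hθ]; norm_num
  have e0 : MOBandit.armMean θ 0 = 1 / 2 := by simp [MOBandit.armMean]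
  have e1 : MOBandit.armMean θ 1 = 1 / 2 + θ := by simp [MOBandit.armMean]
  have hmeans : ∀ h, ∃ m : Fin 2 → ℝ, m 0 < m 1 ∧
      ∀ i d, (MOBandit.coinInstance n h θ hθI).mean i d = m i := fun h =>
    ⟨MOBandit.armMean θ, by rw [e0, e1]; linarith, MOBandit.coinInstance_mean⟩
  have hnear : ∀ h, 0 ≤ h → ∀ i, ∀ᵐ v ∂((MOBandit.coinInstance n h θ hθI).law i), ∀ d,
      |v d - MOBandit.armMean θ i| ≤ h + if i = 0 then θ / 2 else 0 := by
    intro h hh i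
    filter_upwards [MOBandit.ae_isCoinReward i] with v hv d
    have h1 : |v 1 - MOBandit.armMean θ i| ≤ h := by
      rcases hv.coin with e | e <;> rw [e] <;> simp [abs_of_nonneg hh]
    by_cases hd : d = 0
    · subst hd
      have := abs_sub_le (v 0) (v 1) (MOBandit.armMean θ i)
      have := hv.pert
      linarith
    · rw [hv.flat d hd]
      have := (abs_nonneg _).trans hv.pert
      linarith
  have hregret : ∀ κ h : ℝ, 1 / 4 ≤ κ → h = 2 * κ - θ → ∀ T : ℕ, 11 < T → T ≤ 1200 →
      ∀ π : MOBandit.RandomizedAlgorithm 2 (n + 2) T, ENNReal.ofReal (κ * Real.log T) <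
        MOBandit.expectedParetoRegret (MOBandit.coinInstance n h θ hθI) π := by
    intro κ h hκ hh T h11 h1200 π
    have hT2 : (T : ℝ) ≤ 1200 := by exact_mod_cast h1200
    refine MOBandit.le_expectedParetoRegret hpos (by omega) ?_ π ?_
      (MOBandit.log_lt_of_horizon hκ hθ hh h11 h1200)
    · rw [hh, hθ]; linarith
    · exact mul_nonneg (by linarith) (Real.log_natCast_nonneg T)
  -- The coin sizes are the bounds `1 / 2` and `2` less `θ`, which leaves room for the shifted mean
  -- in (a) and for the perturbation `θ / 2` in both parts.
  refine ⟨⟨MOBandit.coinInstance n (1 / 2 - θ) θ hθI, hmeans _, ?_,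
    hregret (1 / 4) _ le_rfl (by ring)⟩,
    ⟨MOBandit.coinInstance n (2 - θ) θ hθI, hmeans _, ?_, ?_⟩⟩
  · intro i
    filter_upwards [hnear (1 / 2 - θ) (by linarith [hθI.2]) i] with v hv d
    have h1 := abs_le.1 (hv d)
    fin_cases i
    · simp only [Fin.zero_eta, e0, if_true] at h1
      exact ⟨by linarith, by linarith⟩
    · simp only [Fin.mk_one, e1, one_ne_zero, if_false] at h1
      exact ⟨by linarith, by linarith⟩
  · intro i
    filter_upwards [hnear (2 - θ) (by linarith [hθI.2]) i] with v hv d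
    rw [MOBandit.coinInstance_mean]
    refine (hv d).trans ?_
    split_ifs <;> linarith
  · intro T h11 h1200 π
    simpa using hregret 1 _ (by norm_num) (by ring) T h11 h1200 π
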